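/- Let $N,M\in\mathbb N$, $h>0$, and consider $M$ reactions among $N$ species with stoichiometric coefficients $\nu^\pm_{j\ell}\in\mathbb N$, rates $k_j^\pm\ge 0$ and reaction vectors $\vec\nu_j=(\nu^-_{j\ell}-\nu^+_{j\ell})_{\ell}\in\mathbb Z^N$. Let $\Omega_h=\{\vec x_i=\vec i h:\vec i\in\mathbb Z^N\}$ and $\Omega_h^+=\{\vec x_i=\vec i h:\vec i\in\mathbb N^N\}$, and let $$\tilde\Phi_j^\pm(\vec x_i)=k_j^\pm\prod_{\ell=1}^N \frac{i_\ell!\,h^{\nu^\pm_{j\ell}}}{(i_\ell-\nu^\pm_{j\ell})!}\quad\text{for }\vec x_i\in\Omega_h^+,\qquad \tilde\Phi_j^\pm(\vec x_i)=0\quad\text{for }\vec x_i\in\Omega_h\setminus\Omega_h^+,$$ where $i!/(i-\nu)!=i(i-1)\cdots(i-\nu+1)$ is the falling factorial (so it is $0$ if $i<\nu$). For $u:\Omega_h\to\mathbb R$ set $$H_h(u)(\vec x_i)=\sum_{j:\ \vec x_i+\vec\nu_jh\ge0}\tilde\Phi_j^+(\vec x_i)\Big(e^{\frac{u(\vec x_i+\vec\nu_jh)-u(\vec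 x_i)}{h}}-1\Big)+\sum_{j:\ \vec x_i-\vec\nu_jh\ge0}\tilde\Phi_j^-(\vec x_i)\Big(e^{\frac{u(\vec x_i-\vec\nu_jh)-u(\vec x_i)}{h}}-1\Big).$$ Let $\ell^\infty_{0*}(\Omega_h)$ be the space of bounded functions on $\Omega_h$ that converge to some constant as $|\vec x_i|\to\infty$ with $\vec x_i\in\Omega_h^+$, equipped with the supremum norm, and let $\ell^\infty_{c*}(\Omega_h)$ be the subspace of bounded functions that, for some $R>0$, are constant on $\{\vec x_i\in\Omega_h^+:|\vec x_i|>R\}$. Regard $H_h$ as an operator in $\ell^\infty_{0*}(\Omega_h)$ with domain $D(H_h)=\{u\in\ell^\infty_{0*}(\Omega_h):H_h(u)\in\ell^\infty_{0*}(\Omega_h)\}$. Assume that there is a vector $\vec m\in\mathbb R^N$ with positive components such that $\vec\nu_j\cdot\vec m=0$ for $j=1,\dots,M$. Then for every $\tau>0$ the map $I-\tau H_h:D(H_h)\to\ell^\infty_{0*}(\Omega_h)$ is bijective; for all $t\ge0$ and $u^0\in\ell^\infty_{0*}(\Omega_h)$ the limit $$S_tu^0=\lim_{\tau\to0^+}(I-\tau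 H_h)^{-[t/\tau]}u^0$$ exists in $\ell^\infty_{0*}(\Omega_h)$; and $(S_t)_{t\ge0}$ is a contraction semigroup: $S_0=I$, $S_{s+t}=S_sS_t$, $\|S_tu^0-S_tv^0\|_\infty\le\|u^0-v^0\|_\infty$. Moreover, for every $u^0\in\ell^\infty_{0*}(\Omega_h)$, $u_h(t,\cdot)=S_tu^0$ is the unique $u_h\in C([0,\infty);\ell^\infty_{0*}(\Omega_h))$ with $u_h(0,\cdot)=u^0$ and $$\partial_tu_h(t,\vec x_i)=H_h(u_h(t,\cdot))(\vec x_i)\qquad\text{for all }t>0,\ \vec x_i\in\Omega_h,$$ and it satisfies: (i) $\displaystyle\inf_{\Omega_h}u^0\le\inf_{\Omega_h}u_h(t,\cdot)\le\sup_{\Omega_h}u_h(t,\cdot)\le\sup_{\Omega_h}u^0$ for all $t\ge0$; (ii) $u_h(\cdot,\vec x_i)\in C^1(0,\infty)$ for every $\vec x_i\in\Omega_h$; (iii) if $u^0\in\ell^\infty_{c*}(\Omega_h)$, then $u_h(\cdot,\vec x_i)\in C^1[0,\infty)$ for every $\vec x_i\in\Omega_h$. -/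

import Mathlib

open Filter Topology
open scoped ENNReal

noncomputable section

namespace ChemHJ

/-- `M` reversible reactions among `N` species: reaction `j` turns `∑ νp j ℓ · X_ℓ` into
`∑ νm j ℓ · X_ℓ` with forward rate `kp j` and backward rate `km j`. -/
structure ReactionNetwork (N M : ℕ) where
  /-- stoichiometric coefficients `ν⁺_{jℓ}` -/
  νp : Fin M → Fin N → ℕ
  /-- stoichiometric coefficients `ν⁻_{jℓ}` -/
  νm : Fin M → Fin N → ℕ
  /-- forward rates `k⁺_j` -/
  kp : Fin M → ℝ
  /-- backward rates `k⁻_j` -/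
  km : Fin M → ℝ
  kp_nonneg : ∀ j, 0 ≤ kp j
  km_nonneg : ∀ j, 0 ≤ km j

/-- The reaction vector `ν_j = ν⁻_j - ν⁺_j ∈ ℤ^N`. -/
def ReactionNetwork.ν {N M : ℕ} (R : ReactionNetwork N M) (j : Fin M) : Fin N → ℤ :=
  fun l => (R.νm j l : ℤ) - (R.νp j l : ℤ)

/-- The grid point `x_i = i h ∈ ℝ^N` (Euclidean norm) with index `i ∈ ℤ^N`. The grid
`Ω_h = h ℤ^N` is parametrized by the indices `i`; it satisfies `x_i ± ν_j h = x_{i ± ν_j}`, and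
the nonnegative part `Ω_h⁺` corresponds to the indices `i ≥ 0`. -/
def gridPoint {N : ℕ} (h : ℝ) (i : Fin N → ℤ) : EuclideanSpace ℝ (Fin N) :=
  WithLp.toLp 2 (fun l => (i l : ℝ) * h)

/-- The mesoscopic law of mass action at `x_i`:
`k ∏_ℓ i_ℓ! h^{ν_ℓ} / (i_ℓ - ν_ℓ)!` if `i ≥ 0`, and `0` if some component is negative.
The quotient of factorials is the falling factorial, which is `0` when `i_ℓ < ν_ℓ`. -/
def intensity {N : ℕ} (h k : ℝ) (ν : Fin N → ℕ) (i : Fin N → ℤ) : ℝ :=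
  if ∀ l, 0 ≤ i l then
    k * ∏ l, (((i l).toNat.descFactorial (ν l) : ℕ) : ℝ) * h ^ (ν l)
  else 0

/-- The discrete Hamiltonian `H_h(u)(x_i)` of the WKB form of the backward equation, with the
`no reaction` constraints `x_i ± ν_j h ≥ 0`. -/
def hamiltonian {N M : ℕ} (R : ReactionNetwork N M) (h : ℝ) (u : (Fin N → ℤ) → ℝ)
    (i : Fin N → ℤ) : ℝ :=
  (∑ j with (∀ l, 0 ≤ (i + R.ν j) l),
      intensity h (R.kp j) (R.νp j) i * (Real.exp ((u (i + R.ν j) - u i) / h) - 1))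
  + ∑ j with (∀ l, 0 ≤ (i - R.ν j) l),
      intensity h (R.km j) (R.νm j) i * (Real.exp ((u (i - R.ν j) - u i) / h) - 1)

/-- The Banach space `ℓ^∞(Ω_h)` with the supremum norm. -/
abbrev EllInf (N : ℕ) : Type := lp (fun _ : Fin N → ℤ => ℝ) ∞

/-- The filter `x_i ∈ Ω_h⁺`, `|x_i| → ∞`. -/
def farField (N : ℕ) (h : ℝ) : Filter (Fin N → ℤ) :=
  comap (fun i => ‖gridPoint h i‖) atTop ⊓ 𝓟 {i | ∀ l, 0 ≤ i l}

/-- `ℓ^∞_{0*}(Ω_h)`: bounded grid functions that tend to a constant as `x_i ∈ Ω_h⁺`,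
`|x_i| → ∞`; it carries the supremum norm. -/
def EllZeroStar (N : ℕ) (h : ℝ) : Submodule ℝ (EllInf N) where
  carrier := {u | ∃ c : ℝ, Tendsto (fun i => u i) (farField N h) (𝓝 c)}
  zero_mem' := ⟨0, by simpa using tendsto_const_nhds⟩
  add_mem' := by
    rintro u v ⟨a, ha⟩ ⟨b, hb⟩
    exact ⟨a + b, by simpa using ha.add hb⟩
  smul_mem' := by
    rintro r u ⟨a, ha⟩
    exact ⟨r * a, by simpa using ha.const_mul r⟩

/-- `ℓ^∞_{c*}(Ω_h)`: bounded grid functions that are constant on `x_i ∈ Ω_h⁺`, `|x_i| > R`, for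
some `R > 0`. -/
def EllCStar (N : ℕ) (h : ℝ) : Submodule ℝ (EllInf N) where
  carrier := {u | ∃ c R : ℝ, 0 < R ∧
    ∀ i : Fin N → ℤ, (∀ l, 0 ≤ i l) → R < ‖gridPoint h i‖ → u i = c}
  zero_mem' := ⟨0, 1, one_pos, fun _ _ _ => rfl⟩
  add_mem' := by
    rintro u v ⟨a, R, hR, ha⟩ ⟨b, R', _, hb⟩
    refine ⟨a + b, max R R', lt_max_of_lt_left hR, fun i hi hRi => ?_⟩
    have h1 := ha i hi ((le_max_left _ _).trans_lt hRi)
    have h2 := hb i hi ((le_max_right _ _).trans_lt hRi)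
    simp [h1, h2]
  smul_mem' := by
    rintro r u ⟨a, R, hR, ha⟩
    exact ⟨r * a, R, hR, fun i hi hRi => by simp [ha i hi hRi]⟩

/-- The graph of the operator `H_h : D(H_h) ⊆ ℓ^∞_{0*} → ℓ^∞_{0*}`, whose domain consists of the
`u ∈ ℓ^∞_{0*}` such that the grid function `H_h(u)` again lies in `ℓ^∞_{0*}`. -/
def HGraph {N M : ℕ} (R : ReactionNetwork N M) (h : ℝ) (u w : EllZeroStar N h) : Prop :=
  ∀ i, (w : EllInf N) i = hamiltonian R h (u : EllInf N) i

/-- `u ∈ D(H_h)` solves the resolvent problem `u - τ H_h(u) = f`. -/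
def IsResolventSolution {N M : ℕ} (R : ReactionNetwork N M) (h τ : ℝ)
    (f u : EllZeroStar N h) : Prop :=
  ∃ w, HGraph R h u w ∧ u - τ • w = f

/-- `u ∈ C([0,∞); ℓ^∞_{0*}(Ω_h))` is a global solution of `∂_t u(t,x_i) = H_h(u(t))(x_i)`, `t > 0`,
`x_i ∈ Ω_h`, with `u(0) = u⁰`. Only the values of `u` at `t ≥ 0` matter. -/
structure IsGlobalSolution {N M : ℕ} (R : ReactionNetwork N M) (h : ℝ)
    (u₀ : EllZeroStar N h) (u : ℝ → EllZeroStar N h) : Prop where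
  continuousOn : ContinuousOn u (Set.Ici 0)
  initial : u 0 = u₀
  equation : ∀ t : ℝ, 0 < t → ∀ i : Fin N → ℤ,
    HasDerivAt (fun s => (u s : EllInf N) i) (hamiltonian R h (u t : EllInf N) i) t

end ChemHJ

end

noncomputable section

namespace ChemHJ

/-! The conserved mass `m · i`, with all `m l > 0`, splits the nonnegative grid into finite levels
which no reaction leaves; every other grid point is a level by itself. On each level the problem is
a finite system of ODEs with a maximum principle. Since maxima over a level are attained,
`resolvent_comparison` holds; it makes the resolvent nonexpansive, and Knaster–Tarski makes it
everywhere defined (`exists_resolvent`). A solution is built directly: `w = exp (u / h)` turns the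
equation into a linear one with a positive semigroup preserving constants (`exists_level_solution`).
Comparison makes implicit Euler converge pointwise to any solution (`tendsto_implicitEuler`), which
gives uniqueness and identifies the limit. The passage to the supremum norm rests on `LevelBounded`:
Euler iterates and solutions respect, level by level, the constant bounds of the initial datum. High
mass levels lie far out, where the datum is nearly constant, so everything is controlled off a
finite set (`exists_finite_tail`) and pointwise convergence becomes uniform. -/

/-- Finitely many jumps `i ↦ target j i` with rates `rate j i`, preserving a `level` function
with finite fibers. -/
structure JumpSystem (ι X Q : Type*) where
  rate : ι → X → ℝ
  rate_nonneg : ∀ j i, 0 ≤ rate j i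
  target : ι → X → X
  level : X → Q
  level_target : ∀ j i, level (target j i) = level i
  finite_fiber : ∀ q, {i | level i = q}.Finite

namespace JumpSystem

variable {ι X Q : Type*} (S : JumpSystem ι X Q)

/-- `v` obeys on each level every pair of constant bounds that `u` obeys there. -/
def LevelBounded (u v : X → ℝ) : Prop :=
  ∀ q a b, (∀ k, S.level k = q → a ≤ u k ∧ u k ≤ b) → ∀ k, S.level k = q → a ≤ v k ∧ v k ≤ b

theorem LevelBounded.refl (u : X → ℝ) : S.LevelBounded u u := fun _ _ _ H => H

variable {S} in
theorem LevelBounded.trans {u v w : X → ℝ} (h₁ : S.LevelBounded u v) (h₂ : S.LevelBounded v w) :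
    S.LevelBounded u w := fun q a b H => h₂ q a b (h₁ q a b H)

/-! ### Comparison principle and solvability of the resolvent equation -/

variable [Fintype ι] {h : ℝ}

/-- The nonlinear generator `∑ⱼ aⱼ(i) (exp ((u(σⱼ i) - u i) / h) - 1)`. -/
def ham (h : ℝ) (u : X → ℝ) (i : X) : ℝ :=
  ∑ j, S.rate j i * (Real.exp ((u (S.target j i) - u i) / h) - 1)

theorem ham_const (h c : ℝ) (i : X) : S.ham h (fun _ => c) i = 0 := by
  simp [ham]

theorem ham_mono (hh : 0 < h) {u v : X → ℝ} {i : X}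
    (H : ∀ j, u (S.target j i) - u i ≤ v (S.target j i) - v i) : S.ham h u i ≤ S.ham h v i := by
  refine Finset.sum_le_sum fun j _ => mul_le_mul_of_nonneg_left ?_ (S.rate_nonneg j i)
  have := H j
  gcongr

/-- Comparison principle for the resolvent equation on a single level. -/
theorem resolvent_comparison (hh : 0 < h) {τ : ℝ} (hτ : 0 ≤ τ) {q : Q} {c : ℝ} {u v : X → ℝ}
    (H : ∀ i, S.level i = q → u i - τ * S.ham h u i ≤ v i - τ * S.ham h v i + c)
    {i : X} (hi : S.level i = q) : u i ≤ v i + c := by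
  -- At a maximum of `u - v` over the finite level, the increments of `u` along all jumps are at
  -- most those of `v`, because jumps stay on the level.
  obtain ⟨k, hk, hmax⟩ := Set.exists_max_image _ (fun k => u k - v k) (S.finite_fiber q) ⟨i, hi⟩
  have hk' : S.level k = q := hk
  have h1 : S.ham h u k ≤ S.ham h v k := by
    refine S.ham_mono hh fun j => ?_
    have := hmax (S.target j k) ((S.level_target j k).trans hk')
    linarith
  have h2 := H k hk'
  have h3 := hmax i hi
  have h4 := mul_le_mul_of_nonneg_left h1 hτ
  linarith

/-- Constants solve the resolvent equation with themselves as data, so comparison with them applies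
on each level. -/
theorem levelBounded_of_resolvent (hh : 0 < h) {τ : ℝ} (hτ : 0 ≤ τ) {f u : X → ℝ}
    (H : ∀ i, u i - τ * S.ham h u i = f i) : S.LevelBounded f u := by
  intro q a b hab k hk
  constructor
  · have := S.resolvent_comparison (u := fun _ => a) (v := u) (c := 0) hh hτ (q := q)
      (fun i hi => by rw [S.ham_const, H i]; linarith [(hab i hi).1]) hk
    linarith
  · have := S.resolvent_comparison (v := fun _ => b) (u := u) (c := 0) hh hτ (q := q)
      (fun i hi => by rw [S.ham_const, H i]; linarith [(hab i hi).2]) hk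
    linarith

/-- The scalar equation obtained from the resolvent equation by freezing the neighbouring values. -/
def scalarResolvent (h τ : ℝ) (u : X → ℝ) (i : X) (x : ℝ) : ℝ :=
  x - τ * ∑ j, S.rate j i * (Real.exp ((u (S.target j i) - x) / h) - 1)

theorem scalarResolvent_strictMono (hh : 0 < h) {τ : ℝ} (hτ : 0 ≤ τ) (u : X → ℝ) (i : X) :
    StrictMono (S.scalarResolvent h τ u i) := by
  intro x y hxy
  have : ∑ j, S.rate j i * (Real.exp ((u (S.target j i) - y) / h) - 1) ≤
      ∑ j, S.rate j i * (Real.exp ((u (S.target j i) - x) / h) - 1) := by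
    refine Finset.sum_le_sum fun j _ => mul_le_mul_of_nonneg_left ?_ (S.rate_nonneg j i)
    gcongr
  have := mul_le_mul_of_nonneg_left this hτ
  unfold scalarResolvent
  linarith

theorem scalarResolvent_anti (hh : 0 < h) {τ : ℝ} (hτ : 0 ≤ τ) {u v : X → ℝ} (huv : u ≤ v) (i : X)
    (x : ℝ) : S.scalarResolvent h τ v i x ≤ S.scalarResolvent h τ u i x := by
  have : ∑ j, S.rate j i * (Real.exp ((u (S.target j i) - x) / h) - 1) ≤
      ∑ j, S.rate j i * (Real.exp ((v (S.target j i) - x) / h) - 1) := by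
    refine Finset.sum_le_sum fun j _ => mul_le_mul_of_nonneg_left ?_ (S.rate_nonneg j i)
    have := huv (S.target j i)
    gcongr
  have := mul_le_mul_of_nonneg_left this hτ
  unfold scalarResolvent
  linarith

/-- Replacing all neighbours by `a` or by `b` shows that the scalar function is at most `a` at `a`
and at least `b` at `b`; the intermediate value theorem does the rest. -/
theorem exists_scalarResolvent_eq (hh : 0 < h) {τ : ℝ} (hτ : 0 ≤ τ) {a b : ℝ} {u : X → ℝ}
    (hu : ∀ k, u k ∈ Set.Icc a b) (i : X) {y : ℝ} (hy : y ∈ Set.Icc a b) :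
    ∃ x ∈ Set.Icc a b, S.scalarResolvent h τ u i x = y := by
  have hcont : Continuous (S.scalarResolvent h τ u i) := by
    unfold scalarResolvent
    fun_prop
  have ha : S.scalarResolvent h τ u i a ≤ a := by
    have := S.scalarResolvent_anti hh hτ (u := fun _ => a) (v := u) (fun k => (hu k).1) i a
    simpa [scalarResolvent] using this
  have hb : b ≤ S.scalarResolvent h τ u i b := by
    have := S.scalarResolvent_anti hh hτ (v := fun _ => b) (u := u) (fun k => (hu k).2) i b
    simpa [scalarResolvent] using this
  exact intermediate_value_Icc (hy.1.trans hy.2) hcont.continuousOn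
    ⟨ha.trans hy.1, hy.2.trans hb⟩

/-- Solvability of the resolvent equation for bounded data, by the Knaster–Tarski theorem. -/
theorem exists_resolvent (hh : 0 < h) {τ : ℝ} (hτ : 0 ≤ τ) {a b : ℝ} {f : X → ℝ}
    (hf : ∀ k, f k ∈ Set.Icc a b) :
    ∃ u : X → ℝ, ∀ i, u i - τ * S.ham h u i = f i := by
  rcases isEmpty_or_nonempty X with hX | ⟨⟨i₀⟩⟩
  · exact ⟨f, fun i => hX.elim i⟩
  have hab : a ≤ b := (hf i₀).1.trans (hf i₀).2
  have : Fact (a ≤ b) := ⟨hab⟩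
  -- `T u i` solves the equation at `i` with neighbours frozen at `u`. It is monotone in `u`, so it
  -- has a least fixed point in the complete lattice of functions into `[a, b]`, which solves the
  -- coupled system.
  choose T hTmem hT using fun (u : X → Set.Icc a b) (i : X) =>
    S.exists_scalarResolvent_eq hh hτ (u := fun k => (u k : ℝ)) (fun k => (u k).2) i (hf i)
  let F : (X → Set.Icc a b) →o (X → Set.Icc a b) :=
    ⟨fun u i => ⟨T u i, hTmem u i⟩, by
      intro u v huv i
      change T u i ≤ T v i
      by_contra hlt
      have h1 := S.scalarResolvent_strictMono hh hτ (fun k => (v k : ℝ)) i (not_le.mp hlt)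
      have h2 := S.scalarResolvent_anti hh hτ (u := fun k => (u k : ℝ)) (v := fun k => (v k : ℝ))
        (fun k => huv k) i (T u i)
      rw [hT] at h1 h2
      exact absurd (h1.trans_le h2) (lt_irrefl _)⟩
  have hfix : F F.lfp = F.lfp := F.map_lfp
  refine ⟨fun k => (F.lfp k : ℝ), fun i => ?_⟩
  have h1 : T F.lfp i = (F.lfp i : ℝ) := congrArg Subtype.val (congrFun hfix i)
  have h2 := hT F.lfp i
  rw [h1] at h2
  exact h2

/-! ### Consistency and convergence of the implicit Euler scheme -/

theorem continuousOn_ham {s : Set ℝ} {u : ℝ → X → ℝ} (hc : ∀ i, ContinuousOn (fun t => u t i) s)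
    (i : X) : ContinuousOn (fun t => S.ham h (u t) i) s := by
  unfold ham
  have := hc i
  have := fun j => hc (S.target j i)
  fun_prop

/-- Along any solution, the local truncation error of the implicit Euler scheme is `o(τ)`,
uniformly on bounded time intervals and on each level. -/
theorem exists_truncation_bound {u : ℝ → X → ℝ}
    (hc : ∀ i, ContinuousOn (fun t => u t i) (Set.Ici 0))
    (hd : ∀ t : ℝ, 0 < t → ∀ i, HasDerivAt (fun s => u s i) (S.ham h (u t) i) t)
    (q : Q) (T : ℝ) {ε : ℝ} (hε : 0 < ε) :
    ∃ δ > 0, ∀ t τ : ℝ, 0 ≤ t → 0 < τ → τ < δ → t + τ ≤ T → ∀ k, S.level k = q →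
      |u (t + τ) k - τ * S.ham h (u (t + τ)) k - u t k| ≤ τ * ε := by
  have : Fintype {i | S.level i = q} := (S.finite_fiber q).fintype
  -- Treating the finite level as one vector gives a single `δ` for all its points.
  have hcont : ContinuousOn (fun t (k : {i | S.level i = q}) => S.ham h (u t) k) (Set.Icc 0 T) :=
    continuousOn_pi.2 fun k => (S.continuousOn_ham hc k).mono Set.Icc_subset_Ici_self
  obtain ⟨δ, hδ, H⟩ := Metric.uniformContinuousOn_iff.1
    (isCompact_Icc.uniformContinuousOn_of_continuous hcont) ε hε
  refine ⟨δ, hδ, fun t τ ht hτ hτδ htT k hk => ?_⟩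
  obtain ⟨c, hcm, hceq⟩ := exists_hasDerivAt_eq_slope (fun s => u s k)
    (fun s => S.ham h (u s) k) (show t < t + τ by linarith)
    ((hc k).mono fun s hs => ht.trans hs.1) (fun s hs => hd s (ht.trans_lt hs.1) k)
  have h1 := H c ⟨ht.trans hcm.1.le, hcm.2.le.trans htT⟩ (t + τ) ⟨by linarith, htT⟩ (by
    rw [Real.dist_eq, abs_lt]; constructor <;> linarith [hcm.1, hcm.2])
  have h2 : |S.ham h (u c) k - S.ham h (u (t + τ)) k| ≤ ε :=
    (dist_le_pi_dist _ _ (⟨k, hk⟩ : {i | S.level i = q})).trans h1.le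
  rw [add_sub_cancel_left, eq_div_iff hτ.ne'] at hceq
  have h3 : u (t + τ) k - τ * S.ham h (u (t + τ)) k - u t k =
      τ * (S.ham h (u c) k - S.ham h (u (t + τ)) k) := by linarith
  rw [h3, abs_mul, abs_of_pos hτ]
  exact mul_le_mul_of_nonneg_left h2 hτ.le

theorem tendsto_floor_div_mul {t : ℝ} (ht : 0 ≤ t) :
    Tendsto (fun τ : ℝ => (⌊t / τ⌋₊ : ℝ) * τ) (𝓝[>] 0) (𝓝 t) := by
  have h0 : Tendsto (fun τ : ℝ => t - τ) (𝓝[>] 0) (𝓝 t) := by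
    have : Tendsto (fun τ : ℝ => t - τ) (𝓝 0) (𝓝 (t - 0)) := by
      exact (continuous_const.sub continuous_id).tendsto 0
    rw [sub_zero] at this
    exact this.mono_left nhdsWithin_le_nhds
  refine tendsto_of_tendsto_of_tendsto_of_le_of_le' h0 tendsto_const_nhds ?_ ?_
  · filter_upwards [self_mem_nhdsWithin] with τ hτ
    have hτ : 0 < τ := hτ
    have := (div_lt_iff₀ hτ).1 (Nat.lt_floor_add_one (t / τ))
    linarith
  · filter_upwards [self_mem_nhdsWithin] with τ hτ
    have hτ : 0 < τ := hτ
    exact (le_div_iff₀ hτ).1 (Nat.floor_le (div_nonneg ht hτ.le))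

/-- The implicit Euler scheme converges pointwise to any solution with the same initial value. -/
theorem tendsto_implicitEuler (hh : 0 < h) {u : ℝ → X → ℝ}
    (hc : ∀ i, ContinuousOn (fun t => u t i) (Set.Ici 0))
    (hd : ∀ t : ℝ, 0 < t → ∀ i, HasDerivAt (fun s => u s i) (S.ham h (u t) i) t)
    {Y : ℝ → ℕ → X → ℝ} (hY0 : ∀ τ, Y τ 0 = u 0)
    (hY : ∀ τ : ℝ, 0 < τ → ∀ n i, Y τ (n + 1) i - τ * S.ham h (Y τ (n + 1)) i = Y τ n i)
    {t : ℝ} (ht : 0 ≤ t) (i : X) :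
    Tendsto (fun τ : ℝ => Y τ ⌊t / τ⌋₊ i) (𝓝[>] 0) (𝓝 (u t i)) := by
  have herr : Tendsto (fun τ : ℝ => Y τ ⌊t / τ⌋₊ i - u (⌊t / τ⌋₊ * τ) i) (𝓝[>] 0) (𝓝 0) := by
    rw [Metric.tendsto_nhds]
    intro ε hε
    -- The local errors add up to at most `t` times this tolerance; dividing by `t + 1` also covers
    -- `t = 0`.
    obtain ⟨δ, hδ, H⟩ := S.exists_truncation_bound hc hd (S.level i) t
      (show 0 < ε / (t + 1) by positivity)
    filter_upwards [Ioo_mem_nhdsGT hδ] with τ hτ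
    have key : ∀ n : ℕ, n * τ ≤ t → ∀ k, S.level k = S.level i →
        |Y τ n k - u (n * τ) k| ≤ n * τ * (ε / (t + 1)) := by
      intro n
      induction n with
      | zero => intro _ k _; simp [hY0]
      | succ n ih =>
        intro hn k hk
        push_cast at hn ⊢
        rw [add_mul, one_mul] at hn ⊢
        have ih' := ih (by linarith [hτ.1])
        have htr := H (n * τ) τ (by have := hτ.1; positivity) hτ.1 hτ.2 hn
        rw [abs_le]
        constructor
        -- The exact solution satisfies the Euler step up to the truncation error, and comparison
        -- passes the accumulated error on without amplification.
        · have := S.resolvent_comparison hh hτ.1.le (q := S.level i) (u := u (n * τ + τ))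
            (v := Y τ (n + 1)) (c := (n * τ + τ) * (ε / (t + 1))) (fun l hl => by
              rw [hY τ hτ.1]
              have h1 := abs_le.1 (ih' l hl)
              have h2 := abs_le.1 (htr l hl)
              linarith [h1.1, h2.2]) hk
          linarith
        · have := S.resolvent_comparison hh hτ.1.le (q := S.level i) (v := u (n * τ + τ))
            (u := Y τ (n + 1)) (c := (n * τ + τ) * (ε / (t + 1))) (fun l hl => by
              rw [hY τ hτ.1]
              have h1 := abs_le.1 (ih' l hl)
              have h2 := abs_le.1 (htr l hl)
              linarith [h1.2, h2.1]) hk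
          linarith
    have hle : (⌊t / τ⌋₊ : ℝ) * τ ≤ t :=
      (le_div_iff₀ hτ.1).1 (Nat.floor_le (div_nonneg ht hτ.1.le))
    rw [Real.dist_eq, sub_zero]
    refine (key _ hle i rfl).trans_lt ?_
    calc (⌊t / τ⌋₊ : ℝ) * τ * (ε / (t + 1)) ≤ t * (ε / (t + 1)) := by gcongr
      _ < (t + 1) * (ε / (t + 1)) := by gcongr; linarith
      _ = ε := by field_simp
  have hu : Tendsto (fun τ : ℝ => u (⌊t / τ⌋₊ * τ) i) (𝓝[>] 0) (𝓝 (u t i)) := by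
    refine (hc i t ht).tendsto.comp (tendsto_nhdsWithin_iff.2 ⟨tendsto_floor_div_mul ht, ?_⟩)
    filter_upwards [self_mem_nhdsWithin] with τ hτ
    have hτ : 0 < τ := hτ
    exact Set.mem_Ici.2 (by positivity)
  simpa using herr.add hu

/-! ### Linearization by the Cole–Hopf transform -/

section ColeHopf

variable (q : Q)

/-- The linear map `(w ↦ ∑ⱼ aⱼ (w ∘ σⱼ - w) / h) + lam` on the functions on a level. -/
def shiftedGenerator (h lam : ℝ) :
    ({i // S.level i = q} → ℝ) →ₗ[ℝ] ({i // S.level i = q} → ℝ) where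
  toFun w i := (∑ j, S.rate j i * (w ⟨S.target j i, (S.level_target j i).trans i.2⟩ - w i)) / h
    + lam * w i
  map_add' v w := by
    ext i
    simp only [Pi.add_apply]
    rw [add_add_add_comm, ← add_div, ← Finset.sum_add_distrib, mul_add]
    congr 2
    exact Finset.sum_congr rfl fun j _ => by ring
  map_smul' c w := by
    ext i
    simp only [Pi.smul_apply, smul_eq_mul, RingHom.id_apply]
    rw [mul_add, mul_div_assoc', Finset.mul_sum]
    congr 1
    · congr 1
      exact Finset.sum_congr rfl fun j _ => by ring
    · ring

theorem shiftedGenerator_one (lam : ℝ) : S.shiftedGenerator q h lam 1 = lam • 1 := by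
  ext i
  simp [shiftedGenerator]

/-- For a large shift the generator preserves nonnegativity. -/
theorem exists_shiftedGenerator_nonneg (hh : 0 < h) :
    ∃ lam : ℝ, ∀ w : {i // S.level i = q} → ℝ, 0 ≤ w → 0 ≤ S.shiftedGenerator q h lam w := by
  have hfin : Finite {i // S.level i = q} := S.finite_fiber q
  -- The only negative contribution is the diagonal one; the shift must dominate the total jump rate
  -- over `h` at every point of the finite level.
  obtain ⟨lam, hlam⟩ := (Set.finite_range
    fun i : {i // S.level i = q} => (∑ j, S.rate j i) / h).bddAbove
  refine ⟨lam, fun w hw i => ?_⟩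
  have h1 : (∑ j, S.rate j i) / h ≤ lam := hlam ⟨i, rfl⟩
  have h2 := mul_le_mul_of_nonneg_right h1 (hw i)
  have h3 : 0 ≤ (∑ j, S.rate j i * w ⟨S.target j i, (S.level_target j i).trans i.2⟩) / h :=
    div_nonneg (Finset.sum_nonneg fun j _ => mul_nonneg (S.rate_nonneg _ _) (hw _)) hh.le
  simp only [shiftedGenerator, LinearMap.coe_mk, AddHom.coe_mk, Pi.zero_apply, mul_sub,
    Finset.sum_sub_distrib, sub_div, ← Finset.sum_mul]
  rw [div_mul_eq_mul_div] at h2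
  linarith

end ColeHopf

/-- Every term of the exponential series is nonnegative. -/
theorem exp_clm_nonneg {Y : Type*} [Fintype Y] {P : (Y → ℝ) →L[ℝ] (Y → ℝ)}
    (hP : ∀ w, 0 ≤ w → 0 ≤ P w) {w : Y → ℝ} (hw : 0 ≤ w) : 0 ≤ NormedSpace.exp P w := by
  intro i
  have h1 := NormedSpace.exp_series_hasSum_exp' (𝕂 := ℝ) P
  have h2 := h1.mapL ((ContinuousLinearMap.proj (R := ℝ) (φ := fun _ : Y => ℝ) i).comp
    (ContinuousLinearMap.apply ℝ (Y → ℝ) w))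
  have hpow : ∀ n : ℕ, 0 ≤ (P ^ n) w := by
    intro n
    induction n with
    | zero => simpa using hw
    | succ n ih => rw [pow_succ']; exact hP _ ih
  refine h2.nonneg fun n => ?_
  simp only [ContinuousLinearMap.comp_apply, ContinuousLinearMap.apply_apply,
    smul_apply, ContinuousLinearMap.proj_apply, Pi.smul_apply, smul_eq_mul]
  exact mul_nonneg (by positivity) (hpow n i)

theorem exp_clm_eigenvector {E : Type*} [NormedAddCommGroup E] [NormedSpace ℝ E] [CompleteSpace E]
    {P : E →L[ℝ] E} {w : E} {c : ℝ} (hw : P w = c • w) :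
    NormedSpace.exp P w = Real.exp c • w := by
  have h1 := (NormedSpace.exp_series_hasSum_exp' (𝕂 := ℝ) P).mapL
    (ContinuousLinearMap.apply ℝ E w)
  have h2 := (NormedSpace.exp_series_hasSum_exp' (𝕂 := ℝ) c).smul_const w
  have hpow : ∀ n : ℕ, (P ^ n) w = c ^ n • w := by
    intro n
    induction n with
    | zero => simp
    | succ n ih =>
      rw [pow_succ', mul_apply_eq_comp, ih, map_smul, hw, smul_smul, pow_succ]
  rw [← Real.exp_eq_exp_ℝ] at h2
  refine h1.unique ?_
  convert h2 using 2 with n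
  simp [hpow, smul_smul]

/-- Cole–Hopf: the nonlinear equation on a level has a global solution, which stays within the
bounds of its initial value. -/
theorem exists_level_solution (hh : 0 < h) (q : Q) (u₀ : {i // S.level i = q} → ℝ) :
    ∃ u : ℝ → {i // S.level i = q} → ℝ, u 0 = u₀ ∧
      (∀ t : ℝ, 0 ≤ t → ∀ i, HasDerivAt (fun s => u s i) (∑ j, S.rate j i *
        (Real.exp ((u t ⟨S.target j i, (S.level_target j i).trans i.2⟩ - u t i) / h) - 1)) t) ∧
      ∀ a b, (∀ k, a ≤ u₀ k ∧ u₀ k ≤ b) → ∀ t : ℝ, 0 ≤ t → ∀ k, a ≤ u t k ∧ u t k ≤ b := by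
  have : Fintype {i // S.level i = q} := (S.finite_fiber q).fintype
  obtain ⟨lam, hlam⟩ := S.exists_shiftedGenerator_nonneg q hh
  let P := LinearMap.toContinuousLinearMap (S.shiftedGenerator q h lam)
  have hPapp : ∀ w, P w = S.shiftedGenerator q h lam w := fun _ => rfl
  -- The factor `exp (-(lam * t))` undoes the shift, so this is the semigroup of the unshifted
  -- linear generator. Positivity and invariance of constants give it the maximum principle.
  let flow : ℝ → ({i // S.level i = q} → ℝ) → {i // S.level i = q} → ℝ :=
    fun t w => Real.exp (-(lam * t)) • NormedSpace.exp (t • P) w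
  have flow_nonneg : ∀ t : ℝ, 0 ≤ t → ∀ w, 0 ≤ w → 0 ≤ flow t w := fun t ht w hw =>
    smul_nonneg (Real.exp_pos _).le
      (exp_clm_nonneg (fun v hv => smul_nonneg ht (hlam v hv)) hw)
  have flow_const : ∀ t c : ℝ, flow t (c • 1) = c • 1 := by
    intro t c
    have : (t • P) (c • 1 : {i // S.level i = q} → ℝ) = (lam * t) • (c • 1) := by
      rw [map_smul, smul_apply, hPapp, shiftedGenerator_one]
      simp only [smul_smul]
      congr 1
      ring
    simp only [flow]
    rw [exp_clm_eigenvector this, smul_smul, ← Real.exp_add]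
    simp
  have flow_sub : ∀ t v w, flow t (v - w) = flow t v - flow t w := by
    intro t v w
    simp only [flow, map_sub, smul_sub]
  have flow_ge : ∀ t : ℝ, 0 ≤ t → ∀ w c, (∀ k, c ≤ w k) → ∀ k, c ≤ flow t w k := by
    intro t ht w c hw k
    have := flow_nonneg t ht (w - c • 1) (fun k => by simpa using hw k) k
    rw [flow_sub, flow_const] at this
    simpa using this
  have flow_le : ∀ t : ℝ, 0 ≤ t → ∀ w c, (∀ k, w k ≤ c) → ∀ k, flow t w k ≤ c := by
    intro t ht w c hw k
    have := flow_nonneg t ht (c • 1 - w) (fun k => by simpa using hw k) k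
    rw [flow_sub, flow_const] at this
    simpa using this
  have flow_deriv : ∀ w t i, HasDerivAt (fun s => flow s w i) ((∑ j, S.rate j i *
      (flow t w ⟨S.target j i, (S.level_target j i).trans i.2⟩ - flow t w i)) / h) t := by
    intro w t i
    have h1 : HasDerivAt (fun s : ℝ => Real.exp (-(lam * s))) (Real.exp (-(lam * t)) * -lam) t := by
      have := ((hasDerivAt_id t).const_mul lam).neg.exp
      simpa using this
    have h2 := hasDerivAt_exp_smul_const' (𝕂 := ℝ) P t
    have h3 := h1.smul (h2.clm_apply (hasDerivAt_const t w))
    have h4 := hasDerivAt_pi.1 h3 i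
    refine h4.congr_deriv ?_
    have h5 : (P * NormedSpace.exp (t • P)) w = P (NormedSpace.exp (t • P) w) := rfl
    rw [h5, hPapp]
    simp only [shiftedGenerator, flow, LinearMap.coe_mk, AddHom.coe_mk, map_zero, add_zero,
      Pi.add_apply, Pi.smul_apply, smul_eq_mul, ← mul_sub, mul_left_comm (S.rate _ _),
      ← Finset.mul_sum]
    ring
  have hpos : ∀ t : ℝ, 0 ≤ t → ∀ k, 0 < flow t (fun k => Real.exp (u₀ k / h)) k := by
    intro t ht k
    obtain ⟨a, ha⟩ := (Set.finite_range u₀).bddBelow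
    refine (Real.exp_pos (a / h)).trans_le (flow_ge t ht _ _ (fun l => ?_) k)
    have : a ≤ u₀ l := ha ⟨l, rfl⟩
    gcongr
  -- With `w` the flow and `u = h log w`, one has `∂ₜu = h ∂ₜw / w = ∑ⱼ aⱼ (w ∘ σⱼ / w - 1)`, and
  -- the quotient is `exp ((u ∘ σⱼ - u) / h)`.
  refine ⟨fun t k => h * Real.log (flow t (fun k => Real.exp (u₀ k / h)) k), ?_, ?_, ?_⟩
  · ext k
    simp [flow, NormedSpace.exp_zero, mul_div_cancel₀ _ hh.ne']
  · intro t ht i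
    refine (((flow_deriv _ t i).log (hpos t ht i).ne').const_mul h).congr_deriv ?_
    have hi := hpos t ht i
    rw [div_right_comm, mul_div_cancel₀ _ hh.ne', Finset.sum_div]
    refine Finset.sum_congr rfl fun j _ => ?_
    have hj := hpos t ht ⟨S.target j i, (S.level_target j i).trans i.2⟩
    rw [← mul_sub, mul_div_cancel_left₀ _ hh.ne', Real.exp_sub, Real.exp_log hi, Real.exp_log hj,
      mul_div_assoc, sub_div, div_self hi.ne']
  · intro a b hab t ht k
    constructor
    · have := flow_ge t ht (fun k => Real.exp (u₀ k / h)) (Real.exp (a / h))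
        (fun l => by have := (hab l).1; gcongr) k
      rw [← Real.le_log_iff_exp_le (hpos t ht k), div_le_iff₀ hh] at this
      linarith
    · have := flow_le t ht (fun k => Real.exp (u₀ k / h)) (Real.exp (b / h))
        (fun l => by have := (hab l).2; gcongr) k
      rw [← Real.log_le_iff_le_exp (hpos t ht k), le_div_iff₀ hh] at this
      linarith

/-- Global solvability of the nonlinear equation. -/
theorem exists_solution (hh : 0 < h) (u₀ : X → ℝ) :
    ∃ u : ℝ → X → ℝ, u 0 = u₀ ∧
      (∀ t : ℝ, 0 ≤ t → ∀ i, HasDerivAt (fun s => u s i) (S.ham h (u t) i) t) ∧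
      ∀ t : ℝ, 0 ≤ t → S.LevelBounded u₀ (u t) := by
  choose U hU0 hUd hUb using fun q => S.exists_level_solution hh q (fun i => u₀ i)
  have hU : ∀ q t k (hk : S.level k = q), U (S.level k) t ⟨k, rfl⟩ = U q t ⟨k, hk⟩ := by
    rintro _ t k rfl
    rfl
  refine ⟨fun t i => U (S.level i) t ⟨i, rfl⟩, ?_, ?_, ?_⟩
  · ext i
    simp only [hU0]
  · intro t ht i
    refine (hUd (S.level i) t ht ⟨i, rfl⟩).congr_deriv ?_
    refine Finset.sum_congr rfl fun j _ => ?_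
    simp only [hU (S.level i) t (S.target j i) (S.level_target j i)]
  · intro t ht q a b hab k hk
    subst hk
    exact hUb _ a b (fun l => hab l l.2) t ht _

end JumpSystem

/-! ### Reaction networks as jump systems -/

variable {N M : ℕ}

open Classical in
/-- The move `i ↦ i + ν`, suppressed unless both ends lie in the nonnegative part of the grid. -/
def constrainedMove (ν i : Fin N → ℤ) : Fin N → ℤ :=
  if (∀ l, 0 ≤ i l) ∧ ∀ l, 0 ≤ (i + ν) l then i + ν else i

open Classical in
/-- The conserved mass on the nonnegative part of the grid; the other grid points are separated. -/
def massLevel (m : Fin N → ℝ) (i : Fin N → ℤ) : ℝ ⊕ (Fin N → ℤ) :=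
  if ∀ l, 0 ≤ i l then Sum.inl (∑ l, (i l : ℝ) * m l) else Sum.inr i

theorem massLevel_constrainedMove {m : Fin N → ℝ} {ν : Fin N → ℤ} (hν : ∑ l, (ν l : ℝ) * m l = 0)
    (i : Fin N → ℤ) : massLevel m (constrainedMove ν i) = massLevel m i := by
  unfold constrainedMove
  split_ifs with H
  · rw [massLevel, if_pos H.2, massLevel, if_pos H.1]
    simp [add_mul, Finset.sum_add_distrib, hν]
  · rfl

/-- Each summand is at most the total mass, so positivity of `m` confines `i` to a box. -/
theorem finite_mass_le {m : Fin N → ℝ} (hm : ∀ l, 0 < m l) (K : ℝ) :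
    {i : Fin N → ℤ | (∀ l, 0 ≤ i l) ∧ ∑ l, (i l : ℝ) * m l ≤ K}.Finite := by
  refine (Set.finite_Icc (0 : Fin N → ℤ) (fun l => ⌊K / m l⌋)).subset ?_
  rintro i ⟨hi, hK⟩
  refine ⟨hi, fun l => Int.le_floor.2 ((le_div_iff₀ (hm l)).2 (le_trans ?_ hK))⟩
  exact Finset.single_le_sum (f := fun l => (i l : ℝ) * m l)
    (fun k _ => mul_nonneg (by exact_mod_cast hi k) (hm k).le) (Finset.mem_univ l)

theorem finite_massLevel_fiber {m : Fin N → ℝ} (hm : ∀ l, 0 < m l) (q : ℝ ⊕ (Fin N → ℤ)) :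
    {i | massLevel m i = q}.Finite := by
  cases q with
  | inl K =>
    refine (finite_mass_le hm K).subset fun i hi => ?_
    have hi : massLevel m i = _ := hi
    unfold massLevel at hi
    split_ifs at hi with H
    exact ⟨H, (Sum.inl.inj hi).le⟩
  | inr k =>
    refine (Set.finite_singleton k).subset fun i hi => ?_
    have hi : massLevel m i = _ := hi
    unfold massLevel at hi
    split_ifs at hi with H
    exact Sum.inr.inj hi

theorem intensity_nonneg {h k : ℝ} (hh : 0 < h) (hk : 0 ≤ k) (ν : Fin N → ℕ) (i : Fin N → ℤ) :
    0 ≤ intensity h k ν i := by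
  unfold intensity
  split_ifs
  · have : 0 ≤ ∏ l, (((i l).toNat.descFactorial (ν l) : ℕ) : ℝ) * h ^ (ν l) :=
      Finset.prod_nonneg fun l _ => by positivity
    positivity
  · exact le_rfl

/-- The jump system of a mass conserving reaction network. -/
def ReactionNetwork.jumpSystem (R : ReactionNetwork N M) {h : ℝ} (hh : 0 < h) {m : Fin N → ℝ}
    (hm : ∀ l, 0 < m l) (hmass : ∀ j, ∑ l, (R.ν j l : ℝ) * m l = 0) :
    JumpSystem (Fin M ⊕ Fin M) (Fin N → ℤ) (ℝ ⊕ (Fin N → ℤ)) where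
  rate := Sum.elim (fun j => intensity h (R.kp j) (R.νp j))
    (fun j => intensity h (R.km j) (R.νm j))
  rate_nonneg := by
    rintro (j | j) i
    · exact intensity_nonneg hh (R.kp_nonneg j) _ i
    · exact intensity_nonneg hh (R.km_nonneg j) _ i
  target := Sum.elim (fun j => constrainedMove (R.ν j)) (fun j => constrainedMove (-R.ν j))
  level := massLevel m
  level_target := by
    rintro (j | j) i
    · exact massLevel_constrainedMove (hmass j) i
    · exact massLevel_constrainedMove (by simp [hmass j]) i
  finite_fiber := finite_massLevel_fiber hm

/-- A suppressed jump contributes `exp 0 - 1 = 0`, and the intensity vanishes off the nonnegative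
grid; the constraint in the sum can thus be moved into the jump map. -/
theorem intensity_mul_constrainedMove (h k : ℝ) (a : Fin N → ℕ) (ν i : Fin N → ℤ)
    (u : (Fin N → ℤ) → ℝ) :
    intensity h k a i * (Real.exp ((u (constrainedMove ν i) - u i) / h) - 1) =
      if ∀ l, 0 ≤ (i + ν) l then
        intensity h k a i * (Real.exp ((u (i + ν) - u i) / h) - 1) else 0 := by
  by_cases hi : ∀ l, 0 ≤ i l
  · by_cases hν : ∀ l, 0 ≤ (i + ν) l
    · rw [constrainedMove, if_pos ⟨hi, hν⟩, if_pos hν]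
    · rw [constrainedMove, if_neg (fun H => hν H.2), if_neg hν]
      simp
  · simp [intensity, if_neg hi]

theorem ReactionNetwork.hamiltonian_eq_ham (R : ReactionNetwork N M) {h : ℝ} (hh : 0 < h)
    {m : Fin N → ℝ} (hm : ∀ l, 0 < m l) (hmass : ∀ j, ∑ l, (R.ν j l : ℝ) * m l = 0)
    (u : (Fin N → ℤ) → ℝ) : hamiltonian R h u = (R.jumpSystem hh hm hmass).ham h u := by
  ext i
  simp only [hamiltonian, JumpSystem.ham, jumpSystem, Fintype.sum_sum_type, Sum.elim_inl,
    Sum.elim_inr, intensity_mul_constrainedMove, Finset.sum_filter, sub_eq_add_neg i]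

theorem mass_le_norm_gridPoint {h : ℝ} (hh : 0 < h) {m : Fin N → ℝ} (hm : ∀ l, 0 < m l)
    (i : Fin N → ℤ) : ∑ l, (i l : ℝ) * m l ≤ (∑ l, m l) * (‖gridPoint h i‖ / h) := by
  rw [Finset.sum_mul]
  refine Finset.sum_le_sum fun l _ => ?_
  rw [mul_comm]
  refine mul_le_mul_of_nonneg_left ?_ (hm l).le
  rw [le_div_iff₀ hh]
  have := PiLp.norm_apply_le (gridPoint h i) l
  exact (le_abs_self _).trans this

theorem compl_mem_farField {h : ℝ} {F : Set (Fin N → ℤ)} (hF : F.Finite) :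
    Fᶜ ∈ farField N h := by
  refine mem_inf_of_left ?_
  obtain ⟨b, hb⟩ := (hF.image fun i => ‖gridPoint h i‖).bddAbove
  refine ⟨Set.Ioi b, Ioi_mem_atTop b, fun i hi hiF => ?_⟩
  exact absurd (hb ⟨i, hiF, rfl⟩) (not_le.2 hi)

theorem nonneg_mem_farField (h : ℝ) : {i : Fin N → ℤ | ∀ l, 0 ≤ i l} ∈ farField N h :=
  mem_inf_of_right (mem_principal_self _)

/-! ### Uniform control at infinity -/

section Tail

variable (R : ReactionNetwork N M) {h : ℝ} (hh : 0 < h) {m : Fin N → ℝ} (hm : ∀ l, 0 < m l)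
  (hmass : ∀ j, ∑ l, (R.ν j l : ℝ) * m l = 0)

/-- Off a finite set, grid functions that are levelwise bounded by `u₀` are uniformly close to the
limit of `u₀` on the nonnegative part of the grid and equal to `u₀` elsewhere. -/
theorem exists_finite_tail {u₀ : (Fin N → ℤ) → ℝ} {c : ℝ}
    (hu₀ : Tendsto u₀ (farField N h) (𝓝 c)) {ε : ℝ} (hε : 0 < ε) :
    ∃ F : Set (Fin N → ℤ), F.Finite ∧
      ∀ v, (R.jumpSystem hh hm hmass).LevelBounded u₀ v → ∀ i ∉ F,
        ((∀ l, 0 ≤ i l) → |v i - c| ≤ ε) ∧ ((¬ ∀ l, 0 ≤ i l) → v i = u₀ i) := by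
  have h1 : {i | |u₀ i - c| < ε} ∈ farField N h := hu₀ (Metric.ball_mem_nhds c hε)
  obtain ⟨s, hs, hsub⟩ := mem_inf_principal.1 h1 |> mem_comap.1
  obtain ⟨r, hr⟩ := mem_atTop_sets.1 hs
  -- Beyond this mass every point of a level has norm at least `r`, where `u₀` is already `ε`-close
  -- to `c`.
  refine ⟨_, finite_mass_le hm ((∑ l, m l) * (r / h)), fun v hv i hi => ⟨fun hpos => ?_,
    fun hneg => ?_⟩⟩
  · have hmi : (∑ l, m l) * (r / h) < ∑ l, (i l : ℝ) * m l :=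
      not_le.1 fun H => hi ⟨hpos, H⟩
    have hb : ∀ k, massLevel m k = massLevel m i → c - ε ≤ u₀ k ∧ u₀ k ≤ c + ε := by
      intro k hk
      rw [massLevel, massLevel, if_pos hpos] at hk
      split_ifs at hk with hkpos
      have hk := Sum.inl.inj hk
      have h2 : r ≤ ‖gridPoint h k‖ := by
        by_contra hlt
        have h3 := mass_le_norm_gridPoint hh hm k
        have h4 : (∑ l, m l) * (‖gridPoint h k‖ / h) ≤ (∑ l, m l) * (r / h) := by
          refine mul_le_mul_of_nonneg_left ?_ (Finset.sum_nonneg fun l _ => (hm l).le)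
          have := (not_le.1 hlt).le
          gcongr
        linarith
      have h5 : |u₀ k - c| < ε := hsub (hr _ h2) hkpos
      rw [abs_lt] at h5
      constructor <;> linarith [h5.1, h5.2]
    have := hv (massLevel m i) (c - ε) (c + ε) hb i rfl
    rw [abs_le]
    constructor <;> linarith [this.1, this.2]
  · have := hv (massLevel m i) (u₀ i) (u₀ i) (fun k (hk : massLevel m k = _) => by
      rw [massLevel, massLevel, if_neg hneg] at hk
      split_ifs at hk
      rw [Sum.inr.inj hk]
      exact ⟨le_rfl, le_rfl⟩) i rfl
    exact le_antisymm this.2 this.1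

theorem LevelBounded.tendsto_farField {u₀ v : (Fin N → ℤ) → ℝ} {c : ℝ}
    (hv : (R.jumpSystem hh hm hmass).LevelBounded u₀ v)
    (hu₀ : Tendsto u₀ (farField N h) (𝓝 c)) : Tendsto v (farField N h) (𝓝 c) := by
  refine Metric.tendsto_nhds.2 fun ε hε => ?_
  obtain ⟨F, hF, H⟩ := exists_finite_tail R hh hm hmass hu₀ (half_pos hε)
  filter_upwards [compl_mem_farField hF, nonneg_mem_farField h] with i hi hpos
  exact ((H v hv i hi).1 hpos).trans_lt (half_lt_self hε)

variable {R hh hm hmass} in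
/-- A grid function levelwise bounded by an element of `ℓ^∞_{0*}` belongs to `ℓ^∞_{0*}`. -/
theorem LevelBounded.exists_ellZeroStar {u₀ : EllZeroStar N h} {v : (Fin N → ℤ) → ℝ}
    (hv : (R.jumpSystem hh hm hmass).LevelBounded (u₀ : EllInf N) v) :
    ∃ w : EllZeroStar N h, ((w : EllInf N) : (Fin N → ℤ) → ℝ) = v := by
  have hb : ∀ k, |v k| ≤ ‖u₀‖ := fun k => by
    refine abs_le.2 (hv _ (-‖u₀‖) ‖u₀‖ (fun l _ => abs_le.1 ?_) k rfl)
    exact lp.norm_apply_le_norm (by simp) (u₀ : EllInf N) l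
  have hmem : Memℓp v ∞ := memℓp_infty ⟨‖u₀‖, by rintro _ ⟨k, rfl⟩; exact hb k⟩
  obtain ⟨c, hc⟩ := u₀.2
  exact ⟨⟨⟨v, hmem⟩, c, LevelBounded.tendsto_farField R hh hm hmass hv hc⟩, rfl⟩

variable {R hh hm hmass} in
/-- Pointwise convergence of functions levelwise bounded by a common `u₀` is uniform. -/
theorem LevelBounded.tendsto_of_pointwise {α : Type*} {l : Filter α} {u₀ : EllZeroStar N h}
    {v : α → EllZeroStar N h} {w : EllZeroStar N h}
    (hv : ∀ᶠ a in l, (R.jumpSystem hh hm hmass).LevelBounded (u₀ : EllInf N) (v a : EllInf N))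
    (hw : (R.jumpSystem hh hm hmass).LevelBounded (u₀ : EllInf N) (w : EllInf N))
    (H : ∀ i, Tendsto (fun a => (v a : EllInf N) i) l (𝓝 ((w : EllInf N) i))) :
    Tendsto v l (𝓝 w) := by
  refine Metric.tendsto_nhds.2 fun ε hε => ?_
  obtain ⟨c, hc⟩ := u₀.2
  -- On the nonnegative grid off `F` both functions are within `ε / 4` of `c`; at other points off
  -- `F` both equal `u₀`. Only finitely many points remain.
  obtain ⟨F, hF, hFt⟩ := exists_finite_tail R hh hm hmass hc (show 0 < ε / 4 by linarith)
  have h1 : ∀ᶠ a in l, ∀ i ∈ F, |(v a : EllInf N) i - (w : EllInf N) i| < ε / 2 :=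
    (eventually_all_finite hF).2 fun i _ => Metric.tendsto_nhds.1 (H i) _ (half_pos hε)
  filter_upwards [h1, hv] with a ha hva
  rw [dist_eq_norm]
  refine lt_of_le_of_lt (lp.norm_le_of_forall_le (half_pos hε).le
    (f := ((v a - w : EllZeroStar N h) : EllInf N)) fun i => ?_) (half_lt_self hε)
  change |(v a : EllInf N) i - (w : EllInf N) i| ≤ ε / 2
  by_cases hi : i ∈ F
  · exact (ha i hi).le
  by_cases hpos : ∀ l, 0 ≤ i l
  · have h2 := abs_le.1 ((hFt _ hva i hi).1 hpos)
    have h3 := abs_le.1 ((hFt _ hw i hi).1 hpos)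
    rw [abs_le]
    constructor <;> linarith [h2.1, h2.2, h3.1, h3.2]
  · rw [(hFt _ hva i hi).2 hpos, (hFt _ hw i hi).2 hpos]
    rw [sub_self, abs_zero]
    exact (half_pos hε).le

end Tail

/-! ### The resolvent in `ℓ^∞_{0*}` -/

section Resolvent

variable (R : ReactionNetwork N M) {h : ℝ}

/-- The domain condition is automatic: the equation forces `H_h(u) = (u - f) / τ`, which lies in the
space. -/
theorem isResolventSolution_iff {τ : ℝ} (hτ : 0 < τ) {f u : EllZeroStar N h} :
    IsResolventSolution R h τ f u ↔
      ∀ i, (u : EllInf N) i - τ * hamiltonian R h (u : EllInf N) i = (f : EllInf N) i := by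
  constructor
  · rintro ⟨w, hw, rfl⟩ i
    rw [← hw i]
    rfl
  · intro H
    refine ⟨τ⁻¹ • (u - f), fun i => ?_, ?_⟩
    · change τ⁻¹ * ((u : EllInf N) i - (f : EllInf N) i) = _
      rw [← H i]
      field_simp
      ring
    · rw [smul_inv_smul₀ hτ.ne', sub_sub_cancel]

theorem exists_isResolventSolution (hh : 0 < h) {m : Fin N → ℝ} (hm : ∀ l, 0 < m l)
    (hmass : ∀ j, ∑ l, (R.ν j l : ℝ) * m l = 0) {τ : ℝ} (hτ : 0 < τ) (f : EllZeroStar N h) :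
    ∃ u, IsResolventSolution R h τ f u := by
  obtain ⟨u, hu⟩ := (R.jumpSystem hh hm hmass).exists_resolvent hh hτ.le
    (f := (f : EllInf N)) (a := -‖f‖) (b := ‖f‖)
    (fun k => abs_le.1 (lp.norm_apply_le_norm (by simp) (f : EllInf N) k))
  obtain ⟨w, rfl⟩ := LevelBounded.exists_ellZeroStar
    ((R.jumpSystem hh hm hmass).levelBounded_of_resolvent hh hτ.le hu)
  refine ⟨w, (isResolventSolution_iff R hτ).2 fun i => ?_⟩
  rw [R.hamiltonian_eq_ham hh hm hmass, hu]

/-- The resolvent is nonexpansive. -/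
theorem IsResolventSolution.norm_sub_le (hh : 0 < h) {m : Fin N → ℝ} (hm : ∀ l, 0 < m l)
    (hmass : ∀ j, ∑ l, (R.ν j l : ℝ) * m l = 0) {τ : ℝ} (hτ : 0 < τ) {f g u v : EllZeroStar N h}
    (hu : IsResolventSolution R h τ f u) (hv : IsResolventSolution R h τ g v) :
    ‖u - v‖ ≤ ‖f - g‖ := by
  have key : ∀ {f g u v : EllZeroStar N h}, IsResolventSolution R h τ f u →
      IsResolventSolution R h τ g v → ∀ i, (u : EllInf N) i ≤ (v : EllInf N) i + ‖f - g‖ := by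
    intro f g u v hu hv i
    rw [isResolventSolution_iff R hτ, R.hamiltonian_eq_ham hh hm hmass] at hu hv
    refine (R.jumpSystem hh hm hmass).resolvent_comparison hh hτ.le (fun k _ => ?_) rfl
    have : |(f : EllInf N) k - (g : EllInf N) k| ≤ ‖f - g‖ :=
      lp.norm_apply_le_norm (by simp) ((f - g : EllZeroStar N h) : EllInf N) k
    rw [hu k, hv k]
    linarith [(abs_le.1 this).2]
  refine lp.norm_le_of_forall_le (norm_nonneg _)
    (f := ((u - v : EllZeroStar N h) : EllInf N)) fun i => ?_
  change |(u : EllInf N) i - (v : EllInf N) i| ≤ _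
  have h1 := key hu hv i
  have h2 := key hv hu i
  rw [norm_sub_rev] at h2
  rw [abs_le]
  constructor <;> linarith

end Resolvent

theorem contDiffOn_Ici_one_of_hasDerivWithinAt {f f' : ℝ → ℝ}
    (hf : ∀ t, 0 ≤ t → HasDerivWithinAt f (f' t) (Set.Ici 0) t)
    (hf' : ContinuousOn f' (Set.Ici 0)) : ContDiffOn ℝ 1 f (Set.Ici 0) := by
  rw [contDiffOn_one_iff_derivWithin (uniqueDiffOn_Ici 0)]
  refine ⟨fun t ht => (hf t ht).differentiableWithinAt, hf'.congr fun t ht => ?_⟩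
  exact (hf t ht).derivWithin (uniqueDiffOn_Ici 0 t ht)

end ChemHJ

end

/-! ### The semigroup and its properties -/

theorem mainTheorem3 {N M : ℕ} (R : ChemHJ.ReactionNetwork N M) (h : ℝ) (hh : 0 < h)
    (m : Fin N → ℝ) (hm : ∀ l, 0 < m l)
    (hmass : ∀ j, ∑ l, (R.ν j l : ℝ) * m l = 0) :
    ∃ (J S : ℝ → ChemHJ.EllZeroStar N h → ChemHJ.EllZeroStar N h),
      -- `J τ = (I - τ H_h)⁻¹` is everywhere defined and single valued
      (∀ τ : ℝ, 0 < τ → ∀ f u, ChemHJ.IsResolventSolution R h τ f u ↔ u = J τ f) ∧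
      -- `S t u⁰ = lim_{τ → 0+} (I - τ H_h)^{-[t/τ]} u⁰` in the supremum norm
      (∀ t : ℝ, 0 ≤ t → ∀ u₀,
        Tendsto (fun τ : ℝ => (J τ)^[⌊t / τ⌋₊] u₀) (𝓝[>] 0) (𝓝 (S t u₀))) ∧
      -- `S` is a contraction semigroup
      (∀ u₀, S 0 u₀ = u₀) ∧
      (∀ s t : ℝ, 0 ≤ s → 0 ≤ t → ∀ u₀, S (s + t) u₀ = S s (S t u₀)) ∧
      (∀ t : ℝ, 0 ≤ t → ∀ u₀ v₀, ‖S t u₀ - S t v₀‖ ≤ ‖u₀ - v₀‖) ∧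
      -- for every initial datum `t ↦ S t u⁰` is the unique global solution
      ∀ u₀ : ChemHJ.EllZeroStar N h,
        ChemHJ.IsGlobalSolution R h u₀ (fun t => S t u₀) ∧
        (∀ v : ℝ → ChemHJ.EllZeroStar N h, ChemHJ.IsGlobalSolution R h u₀ v →
          Set.EqOn v (fun t => S t u₀) (Set.Ici 0)) ∧
        (∀ t : ℝ, 0 ≤ t →
          (⨅ i, (u₀ : ChemHJ.EllInf N) i) ≤ ⨅ i, (S t u₀ : ChemHJ.EllInf N) i ∧
          (⨅ i, (S t u₀ : ChemHJ.EllInf N) i) ≤ ⨆ i, (S t u₀ : ChemHJ.EllInf N) i ∧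
          (⨆ i, (S t u₀ : ChemHJ.EllInf N) i) ≤ ⨆ i, (u₀ : ChemHJ.EllInf N) i) ∧
        (∀ i, ContDiffOn ℝ 1 (fun t => (S t u₀ : ChemHJ.EllInf N) i) (Set.Ioi 0)) ∧
        ((u₀ : ChemHJ.EllInf N) ∈ ChemHJ.EllCStar N h →
          ∀ i, ContDiffOn ℝ 1 (fun t => (S t u₀ : ChemHJ.EllInf N) i) (Set.Ici 0)) := by
  have hcont : ∀ {u : ℝ → ChemHJ.EllZeroStar N h}, ContinuousOn u (Set.Ici 0) →
      ∀ i, ContinuousOn (fun t => (u t : ChemHJ.EllInf N) i) (Set.Ici 0) := by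
    intro u hu i t ht
    have h1 : Tendsto u (𝓝[Set.Ici 0] t) (𝓝 (u t)) := hu t ht
    refine tendsto_iff_dist_tendsto_zero.2 (squeeze_zero (fun _ => dist_nonneg) (fun s => ?_)
      (tendsto_iff_dist_tendsto_zero.1 h1))
    rw [dist_eq_norm, dist_eq_norm]
    exact lp.norm_apply_le_norm (by simp) ((u s - u t : ChemHJ.EllZeroStar N h) : ChemHJ.EllInf N) i
  have hHam := R.hamiltonian_eq_ham hh hm hmass
  have hJex : ∀ (τ : ℝ) (f : ChemHJ.EllZeroStar N h),
      ∃ u, 0 < τ → ChemHJ.IsResolventSolution R h τ f u := by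
    intro τ f
    by_cases hτ : 0 < τ
    · obtain ⟨u, hu⟩ := ChemHJ.exists_isResolventSolution R hh hm hmass hτ f
      exact ⟨u, fun _ => hu⟩
    · exact ⟨0, fun H => absurd H hτ⟩
  choose J hJ using hJex
  have hSex : ∀ u₀ : ChemHJ.EllZeroStar N h, ∃ U : ℝ → ChemHJ.EllZeroStar N h, U 0 = u₀ ∧
      (∀ t : ℝ, 0 ≤ t → ∀ i, HasDerivWithinAt (fun s => (U s : ChemHJ.EllInf N) i)
        (ChemHJ.hamiltonian R h (U t : ChemHJ.EllInf N) i) (Set.Ici 0) t) ∧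
      ∀ t : ℝ, 0 ≤ t → (R.jumpSystem hh hm hmass).LevelBounded (u₀ : ChemHJ.EllInf N)
        (U t : ChemHJ.EllInf N) := by
    intro u₀
    obtain ⟨u, hu0, hud, hub⟩ := (R.jumpSystem hh hm hmass).exists_solution hh
      (u₀ : ChemHJ.EllInf N)
    -- The bounds hold only for `t ≥ 0`; freezing time at `0` before that makes `U` total, at the
    -- price of a one-sided derivative at `0`.
    choose U hU using fun t : ℝ =>
      ChemHJ.LevelBounded.exists_ellZeroStar (hub (max t 0) (le_max_right t 0))
    have hU' : ∀ t : ℝ, 0 ≤ t → ((U t : ChemHJ.EllInf N) : (Fin N → ℤ) → ℝ) = u t := by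
      intro t ht
      rw [hU, max_eq_left ht]
    refine ⟨U, ?_, fun t ht i => ?_, fun t ht => hU t ▸ hub _ (le_max_right t 0)⟩
    · ext i
      rw [hU' 0 le_rfl, hu0]
    · rw [hU' t ht, hHam]
      exact (hud t ht i).hasDerivWithinAt.congr (fun s hs => by rw [hU' s hs]) (by rw [hU' t ht])
  choose V hV0 hVd hVb using hSex
  have hJbdd : ∀ (τ : ℝ), 0 < τ → ∀ (n : ℕ) (u₀ : ChemHJ.EllZeroStar N h),
      (R.jumpSystem hh hm hmass).LevelBounded (u₀ : ChemHJ.EllInf N)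
        ((J τ)^[n] u₀ : ChemHJ.EllInf N) := by
    intro τ hτ n u₀
    induction n with
    | zero => exact ChemHJ.JumpSystem.LevelBounded.refl _ _
    | succ n ih =>
      rw [Function.iterate_succ_apply']
      refine ih.trans ((R.jumpSystem hh hm hmass).levelBounded_of_resolvent hh hτ.le fun i => ?_)
      rw [← hHam]
      exact (ChemHJ.isResolventSolution_iff R hτ).1 (hJ τ _ hτ) i
  have hEuler : ∀ (u₀ : ChemHJ.EllZeroStar N h) (v : ℝ → ChemHJ.EllZeroStar N h),
      ChemHJ.IsGlobalSolution R h u₀ v → ∀ t : ℝ, 0 ≤ t → ∀ i,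
        Tendsto (fun τ : ℝ => ((J τ)^[⌊t / τ⌋₊] u₀ : ChemHJ.EllInf N) i) (𝓝[>] 0)
          (𝓝 ((v t : ChemHJ.EllInf N) i)) := by
    intro u₀ v hv t ht i
    refine (R.jumpSystem hh hm hmass).tendsto_implicitEuler hh
      (u := fun t => (v t : ChemHJ.EllInf N)) (hcont hv.continuousOn)
      (fun s hs k => by rw [← hHam]; exact hv.equation s hs k)
      (Y := fun τ n => ((J τ)^[n] u₀ : ChemHJ.EllInf N)) (fun τ => by simp [hv.initial])
      (fun τ hτ n k => ?_) ht i
    rw [← hHam, Function.iterate_succ_apply']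
    exact (ChemHJ.isResolventSolution_iff R hτ).1 (hJ τ _ hτ) k
  have hsol : ∀ u₀, ChemHJ.IsGlobalSolution R h u₀ (V u₀) := by
    intro u₀
    refine ⟨fun t ht => ?_, hV0 u₀, fun t ht i =>
      (hVd u₀ t ht.le i).hasDerivAt (Ici_mem_nhds ht)⟩
    refine ChemHJ.LevelBounded.tendsto_of_pointwise (R := R) (hh := hh) (hm := hm)
      (hmass := hmass) (u₀ := u₀) ?_ (hVb u₀ t ht) fun i =>
        (hVd u₀ t ht i).continuousWithinAt
    filter_upwards [self_mem_nhdsWithin] with s hs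
    exact hVb u₀ s hs
  -- The Euler iterates depend only on `u₀` and converge to every solution.
  have huniq : ∀ u₀ v, ChemHJ.IsGlobalSolution R h u₀ v → Set.EqOn v (V u₀) (Set.Ici 0) := by
    intro u₀ v hv t ht
    ext i
    exact tendsto_nhds_unique (hEuler u₀ v hv t ht i) (hEuler u₀ _ (hsol u₀) t ht i)
  have hlim : ∀ t : ℝ, 0 ≤ t → ∀ u₀,
      Tendsto (fun τ : ℝ => (J τ)^[⌊t / τ⌋₊] u₀) (𝓝[>] 0) (𝓝 (V u₀ t)) := by
    intro t ht u₀
    refine ChemHJ.LevelBounded.tendsto_of_pointwise (R := R) (hh := hh) (hm := hm)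
      (hmass := hmass) (u₀ := u₀) ?_ (hVb u₀ t ht) (hEuler u₀ _ (hsol u₀) t ht)
    filter_upwards [self_mem_nhdsWithin] with τ hτ
    exact hJbdd τ hτ _ u₀
  have hC1 : ∀ u₀ i,
      ContDiffOn ℝ 1 (fun t => (V u₀ t : ChemHJ.EllInf N) i) (Set.Ici 0) := by
    intro u₀ i
    refine ChemHJ.contDiffOn_Ici_one_of_hasDerivWithinAt (fun t ht => hVd u₀ t ht i) ?_
    simp only [hHam]
    exact (R.jumpSystem hh hm hmass).continuousOn_ham (hcont (hsol u₀).continuousOn) i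
  refine ⟨J, fun t u₀ => V u₀ t, ?_, hlim, hV0, ?_, ?_, fun u₀ => ⟨hsol u₀, huniq u₀, ?_,
    fun i => (hC1 u₀ i).mono Set.Ioi_subset_Ici_self, fun _ => hC1 u₀⟩⟩
  · intro τ hτ f u
    refine ⟨fun hu => ?_, fun hu => hu ▸ hJ τ f hτ⟩
    have := ChemHJ.IsResolventSolution.norm_sub_le R hh hm hmass hτ hu (hJ τ f hτ)
    rw [sub_self, norm_zero] at this
    exact sub_eq_zero.1 (norm_le_zero_iff.1 this)
  · intro s t hs ht u₀
    -- The time translate solves the equation with initial value `V u₀ t`, so uniqueness gives the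
    -- semigroup law.
    refine huniq (V u₀ t) (fun s => V u₀ (s + t)) ⟨?_, by simp, fun r hr i => ?_⟩ hs
    · exact (hsol u₀).continuousOn.comp (by fun_prop) fun r (hr : 0 ≤ r) => add_nonneg hr ht
    · exact ((hsol u₀).equation (r + t) (by linarith) i).comp_add_const r t
  · intro t ht u₀ v₀
    -- The bound holds for all iterates of the nonexpansive resolvent and survives the limit.
    refine le_of_tendsto ((hlim t ht u₀).sub (hlim t ht v₀)).norm ?_
    filter_upwards [self_mem_nhdsWithin] with τ hτ
    generalize ⌊t / τ⌋₊ = n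
    induction n with
    | zero => exact le_rfl
    | succ n ih =>
      rw [Function.iterate_succ_apply', Function.iterate_succ_apply']
      exact (ChemHJ.IsResolventSolution.norm_sub_le R hh hm hmass hτ (hJ τ _ hτ)
        (hJ τ _ hτ)).trans ih
  · intro t ht
    have hb : ∀ (u : ChemHJ.EllZeroStar N h) i, |(u : ChemHJ.EllInf N) i| ≤ ‖u‖ := fun u i =>
      lp.norm_apply_le_norm (by simp) (u : ChemHJ.EllInf N) i
    have hbelow : ∀ u : ChemHJ.EllZeroStar N h,
        BddBelow (Set.range fun i => (u : ChemHJ.EllInf N) i) := fun u =>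
      ⟨-‖u‖, by rintro _ ⟨i, rfl⟩; exact (abs_le.1 (hb u i)).1⟩
    have habove : ∀ u : ChemHJ.EllZeroStar N h,
        BddAbove (Set.range fun i => (u : ChemHJ.EllInf N) i) := fun u =>
      ⟨‖u‖, by rintro _ ⟨i, rfl⟩; exact (abs_le.1 (hb u i)).2⟩
    have key := fun k => hVb u₀ t ht _ _ _
      (fun k _ => ⟨ciInf_le (hbelow u₀) k, le_ciSup (habove u₀) k⟩) k rfl
    exact ⟨le_ciInf fun k => (key k).1,
      (ciInf_le (hbelow _) 0).trans (le_ciSup (habove (V u₀ t)) 0), ciSup_le fun k => (key k).2⟩
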